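/- Let $p$ be a prime, $K$ a finite extension of $\mathbb{Q}_p$ with the absolute value $|\cdot|$ extending the one with $|p|=p^{-1}$, and $\mathcal{O}_K=\{x\in K : |x|\le 1\}$. Let $g,n\ge 1$ be integers and let $f=(f_{ij})\in M_g(\mathcal{O}_K[[t]])$. For $x=(x_1,\dots,x_g)\in (tK[[t]])^g$ put $H_f(x)=\big(f_{ij}(x_j(t))\big)_{i,j}\in M_g(K[[t]])$, and assume $H_f(0)\in \mathrm{GL}_g(\mathcal{O}_K)$. For $G\in K[[t]]^g$ let $X(G)\in (tK[[t]])^g$ denote the unique solution in $(tK[[t]])^g$ of the differential system $H_f(X)\cdot X'=G$; its class modulo $t^{n+1}$ depends only on $G \bmod t^n$. With $$E_n=\big(K[[t]]/(t^n)\big)^g,\qquad F_n=\big(tK[[t]]/(t^{n+1})\big)^g,$$ this defines the solution map $X_n:E_n\to F_n$, $G\mapsto X(G)\bmod t^{n+1}$. Equip $F_n$ with the Gauss norm $\|x\|_{F_n}=\max_i\max_k |x_{i,k}|$, where $x_{i,k}$ is the coefficient of $t^k$ in $x_i$, and $E_n$ with the integrated Gauss norm $\|G\|_{E_n}=\|\int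 G\|_{F_n}$, where $\int$ is formal integration with zero constant term. Let $B_{E_n}(\delta)$ and $B_{F_n}(\delta)$ be the closed balls of center $0$ and radius $\delta$. Let $G\in(\mathcal{O}_K[[t]]/(t^n))^g$ be such that $X_n(G) \bmod t^n$ has coefficients in $\mathcal{O}_K$ (in particular, this covers the case $X_n(G)\in (t\mathcal{O}_K[[t]]/(t^{n+1}))^g$). Then for every real $\delta<p^{-2/(p-1)}$, $$X_n\big(G+B_{E_n}(\delta)\big)=X_n(G)+B_{F_n}(\delta).$$ -/

import Mathlib

open PowerSeries

noncomputable section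

namespace PadicODE

/-! ### The ring of integers of a finite extension of `ℚ_[p]` -/

/-- The ring of integers `O_K = {x | ‖x‖ ≤ 1}` of a normed field extension `K` of `ℚ_[p]`. -/
def integerRing (p : ℕ) [Fact p.Prime] (K : Type*) [NormedField K] [NormedAlgebra ℚ_[p] K] :
    Subring K where
  carrier := {x | ‖x‖ ≤ 1}
  one_mem' := by simp
  zero_mem' := by simp
  mul_mem' := by
    intro a b ha hb
    exact (norm_mul a b).trans_le (mul_le_one₀ ha (norm_nonneg b) hb)
  add_mem' := by
    intro a b ha hb
    have : IsUltrametricDist K := IsUltrametricDist.of_normedAlgebra ℚ_[p]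
    exact (IsUltrametricDist.norm_add_le_max a b).trans (max_le ha hb)
  neg_mem' := by
    intro a ha
    simpa using ha

section Algebra

variable {K : Type*} [Field K] {g : ℕ}

/-! ### The differential equation `H_f(X) · X' = G` -/

/-- The map `H_f : (t K⟦t⟧)^g → M_g(K⟦t⟧)`, `(x_1, …, x_g) ↦ (f_{ij}(x_j))_{ij}`. -/
def Hf (f : Matrix (Fin g) (Fin g) K⟦X⟧) (x : Fin g → K⟦X⟧) : Matrix (Fin g) (Fin g) K⟦X⟧ :=
  Matrix.of fun i j => (f i j).subst (x j)

/-- `x ∈ (t K⟦t⟧)^g` and `H_f(x) · x' = G`. -/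
def IsSolution (f : Matrix (Fin g) (Fin g) K⟦X⟧) (G x : Fin g → K⟦X⟧) : Prop :=
  (∀ i, constantCoeff (x i) = 0) ∧ (Hf f x).mulVec (fun j => d⁄dX K (x j)) = G

/-- The solution `X(G) ∈ (t K⟦t⟧)^g` of `H_f(X) · X' = G`. When `H_f(0)` is invertible over `K` it
exists and is unique, see `existsUnique_isSolution` and `isSolution_solution` below. -/
def solution (f : Matrix (Fin g) (Fin g) K⟦X⟧) (G : Fin g → K⟦X⟧) : Fin g → K⟦X⟧ :=
  Classical.epsilon (IsSolution f G)

/-- The formal integral `∫ a`: the antiderivative of `a` with zero constant term. -/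
def integral (a : K⟦X⟧) : K⟦X⟧ :=
  PowerSeries.mk fun k =>
    match k with
    | 0 => 0
    | m + 1 => coeff m a / ((m : K) + 1)

/-! ### Truncated power series -/

/-- `K_n = K⟦t⟧ / (t^n)`. -/
abbrev Trunc (K : Type*) [Field K] (n : ℕ) : Type _ := K⟦X⟧ ⧸ Ideal.span {(X : K⟦X⟧) ^ n}

/-- The class of a power series modulo `t^n`. -/
abbrev Trunc.mk (n : ℕ) (a : K⟦X⟧) : Trunc K n := Ideal.Quotient.mk _ a

theorem Trunc.mk_eq_mk {n : ℕ} {a b : K⟦X⟧} : Trunc.mk n a = Trunc.mk n b ↔ X ^ n ∣ a - b := by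
  rw [Ideal.Quotient.eq, Ideal.mem_span_singleton]

/-- The coefficient of `t^k`, `k < n`, of an element of `K⟦t⟧ / (t^n)`. -/
def Trunc.coeff {n : ℕ} (k : Fin n) (a : Trunc K n) : K :=
  Quotient.liftOn' a (PowerSeries.coeff (k : ℕ)) (by
    intro a b h
    have h' : X ^ n ∣ a - b := Trunc.mk_eq_mk.1 (Quotient.sound' h)
    have := X_pow_dvd_iff.1 h' k k.2
    rw [map_sub] at this
    exact sub_eq_zero.1 this)

theorem Trunc.coeff_mk {n : ℕ} (k : Fin n) (a : K⟦X⟧) :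
    Trunc.coeff k (Trunc.mk n a) = PowerSeries.coeff (k : ℕ) a := rfl

/-- `E_n = (K⟦t⟧ / (t^n))^g`. -/
abbrev E (K : Type*) [Field K] (g n : ℕ) : Type _ := Fin g → Trunc K n

/-- `t K⟦t⟧ / (t^{n+1})`, the ideal generated by `t` in `K⟦t⟧ / (t^{n+1})`. -/
abbrev tTrunc (K : Type*) [Field K] (n : ℕ) : Ideal (Trunc K (n + 1)) :=
  Ideal.span {Trunc.mk (n + 1) (X : K⟦X⟧)}

/-- `F_n = (t K⟦t⟧ / (t^{n+1}))^g`. -/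
abbrev F (K : Type*) [Field K] (g n : ℕ) : Type _ := Fin g → tTrunc K n

theorem mk_mem_tTrunc (n : ℕ) {a : K⟦X⟧} (ha : constantCoeff a = 0) :
    Trunc.mk (n + 1) a ∈ tTrunc K n := by
  obtain ⟨b, rfl⟩ := X_dvd_iff.2 ha
  exact Ideal.mem_span_singleton.2 ⟨Trunc.mk (n + 1) b, map_mul _ _ _⟩

theorem constantCoeff_integral (a : K⟦X⟧) : constantCoeff (integral a) = 0 := by
  rw [← coeff_zero_eq_constantCoeff_apply, integral, coeff_mk]

theorem coeff_succ_integral (a : K⟦X⟧) (m : ℕ) :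
    coeff (m + 1) (integral a) = coeff m a / ((m : K) + 1) := by
  rw [integral, coeff_mk]

theorem X_pow_dvd_integral_sub {n : ℕ} {a b : K⟦X⟧} (h : X ^ n ∣ a - b) :
    X ^ (n + 1) ∣ integral a - integral b := by
  rw [X_pow_dvd_iff] at h ⊢
  intro m hm
  cases m with
  | zero => simp [constantCoeff_integral]
  | succ m =>
    have := h m (by omega)
    rw [map_sub] at this ⊢
    rw [coeff_succ_integral, coeff_succ_integral, sub_eq_zero.1 this, sub_self]

/-- Formal integration `∫ : K⟦t⟧ / (t^n) → t K⟦t⟧ / (t^{n+1})`. -/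
def Trunc.integral {n : ℕ} (a : Trunc K n) : tTrunc K n :=
  Quotient.liftOn' a
    (fun a => ⟨Trunc.mk (n + 1) (PadicODE.integral a), mk_mem_tTrunc n (constantCoeff_integral a)⟩)
    (by
      intro a b h
      have h' : X ^ n ∣ a - b := Trunc.mk_eq_mk.1 (Quotient.sound' h)
      exact Subtype.ext (Trunc.mk_eq_mk.2 (X_pow_dvd_integral_sub h')))

theorem Trunc.integral_mk {n : ℕ} (a : K⟦X⟧) :
    (Trunc.integral (Trunc.mk n a) : Trunc K (n + 1)) = Trunc.mk (n + 1) (PadicODE.integral a) :=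
  rfl

/-- The class in `F_n` of a vector of power series `x`; it is only used for `x ∈ (t K⟦t⟧)^g`
(otherwise it is the class of `x - x(0)`). -/
def toF (n : ℕ) (x : Fin g → K⟦X⟧) : F K g n := fun i =>
  ⟨Trunc.mk (n + 1) (x i - C (constantCoeff (x i))), mk_mem_tTrunc n (by simp)⟩

theorem coe_toF (n : ℕ) {x : Fin g → K⟦X⟧} (hx : ∀ i, constantCoeff (x i) = 0) (i : Fin g) :
    (toF n x i : Trunc K (n + 1)) = Trunc.mk (n + 1) (x i) := by
  simp [toF, hx]

/-- The solution map `X_n : E_n → F_n`, `G ↦ X(G) mod t^{n+1}`. When `H_f(0)` is invertible over `K`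
it does not depend on the representative of `G` modulo `t^n`, see `solutionMap_mk` below. -/
def solutionMap (f : Matrix (Fin g) (Fin g) K⟦X⟧) (n : ℕ) (G : E K g n) : F K g n :=
  toF n (solution f fun i => Quotient.out (G i))

/-! ### The solution map is well defined -/

theorem dvd_subst_sub {k : ℕ} (φ : K⟦X⟧) {a b : K⟦X⟧} (ha : constantCoeff a = 0)
    (hb : constantCoeff b = 0) (h : X ^ k ∣ a - b) : X ^ k ∣ φ.subst a - φ.subst b := by
  have hsa := HasSubst.of_constantCoeff_zero' ha
  have hsb := HasSubst.of_constantCoeff_zero' hb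
  have key : ∀ {c : K⟦X⟧} (hc : constantCoeff c = 0), φ.subst c =
      c ^ k * (PowerSeries.mk fun i => coeff (i + k) φ).subst c
        + Polynomial.aeval c (φ.trunc k) := by
    intro c hc
    have hsc := HasSubst.of_constantCoeff_zero' hc
    conv_lhs => rw [eq_X_pow_mul_shift_add_trunc k φ]
    rw [subst_add hsc, subst_mul hsc, subst_pow hsc, subst_X hsc, subst_coe hsc]
  rw [key ha, key hb]
  have h1 : X ^ k ∣ a ^ k := pow_dvd_pow_of_dvd (X_dvd_iff.2 ha) k
  have h2 : X ^ k ∣ b ^ k := pow_dvd_pow_of_dvd (X_dvd_iff.2 hb) k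
  have h3 : X ^ k ∣ Polynomial.aeval a (φ.trunc k) - Polynomial.aeval b (φ.trunc k) := by
    refine h.trans ?_
    rw [← Polynomial.eval_map_algebraMap, ← Polynomial.eval_map_algebraMap]
    exact Polynomial.sub_dvd_eval_sub a b _
  rw [add_sub_add_comm]
  exact dvd_add (dvd_sub (h1.mul_right _) (h2.mul_right _)) h3

/-- The constant term of `H_f(x)`, for `x ∈ (t K⟦t⟧)^g`, as a matrix over `K`. -/
def const (f : Matrix (Fin g) (Fin g) K⟦X⟧) : Matrix (Fin g) (Fin g) K :=
  f.map constantCoeff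

theorem Hf_zero (f : Matrix (Fin g) (Fin g) K⟦X⟧) : Hf f 0 = (const f).map C := by
  ext1 i j
  simp only [Hf, const, Matrix.of_apply, Matrix.map_apply, Pi.zero_apply]
  exact subst_zero_eq_C_constantCoeff

theorem const_Hf (f : Matrix (Fin g) (Fin g) K⟦X⟧) {x : Fin g → K⟦X⟧}
    (hx : ∀ i, constantCoeff (x i) = 0) : (Hf f x).map constantCoeff = const f := by
  ext1 i j
  have h := dvd_subst_sub (k := 1) (f i j) (hx j) (map_zero _)
    (by simpa using X_dvd_iff.2 (hx j))
  have h0 : (f i j).subst (0 : K⟦X⟧) = C (constantCoeff (f i j)) := subst_zero_eq_C_constantCoeff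
  rw [pow_one, X_dvd_iff, map_sub, sub_eq_zero, h0] at h
  simpa [Hf, const] using h

theorem isUnit_det_Hf {f : Matrix (Fin g) (Fin g) K⟦X⟧} (hf : IsUnit (const f).det)
    {x : Fin g → K⟦X⟧} (hx : ∀ i, constantCoeff (x i) = 0) : IsUnit (Hf f x).det := by
  rw [isUnit_iff_constantCoeff, RingHom.map_det, RingHom.mapMatrix_apply, const_Hf f hx]
  exact hf

theorem dvd_mulVec {c : K⟦X⟧} (M : Matrix (Fin g) (Fin g) K⟦X⟧) {v : Fin g → K⟦X⟧}
    (h : ∀ i, c ∣ v i) (i : Fin g) : c ∣ M.mulVec v i := by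
  rw [Matrix.mulVec, dotProduct]
  exact Finset.dvd_sum fun j _ => (h j).mul_left _

theorem dvd_Hf_sub_mulVec (f : Matrix (Fin g) (Fin g) K⟦X⟧) {x y : Fin g → K⟦X⟧}
    (hx : ∀ i, constantCoeff (x i) = 0) (hy : ∀ i, constantCoeff (y i) = 0) {k : ℕ}
    (h : ∀ i, X ^ k ∣ x i - y i) (v : Fin g → K⟦X⟧) (i : Fin g) :
    X ^ k ∣ (Hf f x - Hf f y).mulVec v i := by
  rw [Matrix.mulVec, dotProduct]
  exact Finset.dvd_sum fun j _ => (dvd_subst_sub (f i j) (hx j) (hy j) (h j)).mul_right _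

theorem dvd_of_dvd_mulVec {c : K⟦X⟧} {M : Matrix (Fin g) (Fin g) K⟦X⟧} (hM : IsUnit M.det)
    {v : Fin g → K⟦X⟧} (h : ∀ i, c ∣ M.mulVec v i) (i : Fin g) : c ∣ v i := by
  have := dvd_mulVec M⁻¹ h i
  rwa [Matrix.mulVec_mulVec, Matrix.nonsing_inv_mul _ hM, Matrix.one_mulVec] at this

theorem eq_of_forall_X_pow_dvd {a b : K⟦X⟧} (h : ∀ k, X ^ k ∣ a - b) : a = b := by
  ext m
  have := X_pow_dvd_iff.1 (h (m + 1)) m (by omega)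
  rw [map_sub] at this
  exact sub_eq_zero.1 this

section CharZero

variable [CharZero K]

theorem derivative_integral (a : K⟦X⟧) : d⁄dX K (integral a) = a := by
  ext m
  rw [coeff_derivative, coeff_succ_integral]
  have : (m : K) + 1 ≠ 0 := by exact_mod_cast Nat.succ_ne_zero m
  field_simp

theorem dvd_of_dvd_derivative {k : ℕ} {a : K⟦X⟧} (h0 : constantCoeff a = 0)
    (h : X ^ k ∣ d⁄dX K a) : X ^ (k + 1) ∣ a := by
  rw [X_pow_dvd_iff] at h ⊢
  intro m hm
  cases m with
  | zero => simpa using h0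
  | succ m =>
    have h1 := h m (by omega)
    rw [coeff_derivative] at h1
    have : (m : K) + 1 ≠ 0 := by exact_mod_cast Nat.succ_ne_zero m
    exact (mul_eq_zero.1 h1).resolve_right this

/-- Solutions for right hand sides that agree modulo `t^n` agree modulo `t^{n+1}`. -/
theorem IsSolution.congr_mod {f : Matrix (Fin g) (Fin g) K⟦X⟧} (hf : IsUnit (const f).det)
    {G G' x y : Fin g → K⟦X⟧} (hx : IsSolution f G x) (hy : IsSolution f G' y) {n : ℕ}
    (hG : ∀ i, X ^ n ∣ G i - G' i) (i : Fin g) : X ^ (n + 1) ∣ x i - y i := by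
  have key : ∀ k ≤ n + 1, ∀ i, X ^ k ∣ x i - y i := by
    intro k
    induction k with
    | zero => intro _ i; simp
    | succ k ih =>
      intro hk i
      refine dvd_of_dvd_derivative (by rw [map_sub, hx.1 i, hy.1 i, sub_zero]) ?_
      have hv : ∀ i, X ^ k ∣
          (Hf f x).mulVec (fun j => d⁄dX K (x j) - d⁄dX K (y j)) i := by
        intro i
        have e : (Hf f x).mulVec (fun j => d⁄dX K (x j) - d⁄dX K (y j))
            = (G - G') - (Hf f x - Hf f y).mulVec (fun j => d⁄dX K (y j)) := by
          rw [← hx.2, ← hy.2, Matrix.sub_mulVec]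
          have : (fun j => d⁄dX K (x j) - d⁄dX K (y j))
            = (fun j => d⁄dX K (x j)) - (fun j => d⁄dX K (y j)) := rfl
          rw [this, Matrix.mulVec_sub]
          abel
        rw [e]
        exact dvd_sub ((pow_dvd_pow X (by omega)).trans (hG i))
          (dvd_Hf_sub_mulVec f hx.1 hy.1 (ih (by omega)) _ i)
      have := dvd_of_dvd_mulVec (isUnit_det_Hf hf hx.1) hv i
      rwa [map_sub]
  exact key (n + 1) le_rfl i

theorem exists_isSolution {f : Matrix (Fin g) (Fin g) K⟦X⟧} (hf : IsUnit (const f).det)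
    (G : Fin g → K⟦X⟧) : ∃ x, IsSolution f G x := by
  let T : (Fin g → K⟦X⟧) → Fin g → K⟦X⟧ := fun x i => integral (((Hf f x)⁻¹).mulVec G i)
  have hT0 : ∀ x i, constantCoeff (T x i) = 0 := fun x i => constantCoeff_integral _
  have hT : ∀ x y : Fin g → K⟦X⟧, (∀ i, constantCoeff (x i) = 0) →
      (∀ i, constantCoeff (y i) = 0) → ∀ k, (∀ i, X ^ k ∣ x i - y i) →
      ∀ i, X ^ (k + 1) ∣ T x i - T y i := by
    intro x y hx hy k h i
    refine X_pow_dvd_integral_sub ?_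
    have hux := isUnit_det_Hf hf hx
    have huy := isUnit_det_Hf hf hy
    refine dvd_of_dvd_mulVec (v := ((Hf f x)⁻¹).mulVec G - ((Hf f y)⁻¹).mulVec G) hux ?_ i
    intro i
    have e : (Hf f x).mulVec (((Hf f x)⁻¹).mulVec G - ((Hf f y)⁻¹).mulVec G)
        = -((Hf f x - Hf f y).mulVec (((Hf f y)⁻¹).mulVec G)) := by
      rw [Matrix.mulVec_sub, Matrix.sub_mulVec, Matrix.mulVec_mulVec,
        Matrix.mul_nonsing_inv _ hux, Matrix.mulVec_mulVec (M := Hf f y),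
        Matrix.mul_nonsing_inv _ huy, neg_sub]
    rw [e, Pi.neg_apply, dvd_neg]
    exact dvd_Hf_sub_mulVec f hx hy h _ i
  have hI0 : ∀ k i, constantCoeff (T^[k] 0 i) = 0 := by
    intro k i
    cases k with
    | zero => simp
    | succ k => rw [Function.iterate_succ_apply']; exact hT0 _ i
  have hI : ∀ k l i, X ^ k ∣ T^[k + l] 0 i - T^[k] 0 i := by
    intro k
    induction k with
    | zero => intro l i; simp
    | succ k ih =>
      intro l i
      rw [Nat.add_right_comm, Function.iterate_succ_apply', Function.iterate_succ_apply']
      exact hT _ _ (hI0 _) (hI0 _) k (ih l) i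
  let z : Fin g → K⟦X⟧ := fun i => PowerSeries.mk fun m => coeff m (T^[m + 1] 0 i)
  have hz : ∀ k i, X ^ k ∣ z i - T^[k] 0 i := by
    intro k i
    rw [X_pow_dvd_iff]
    intro m hm
    have h1 := X_pow_dvd_iff.1 (hI (m + 1) (k - (m + 1)) i) m (by omega)
    rw [Nat.add_sub_cancel' hm, map_sub] at h1
    rw [map_sub, coeff_mk, ← neg_sub, h1, neg_zero]
  have hz0 : ∀ i, constantCoeff (z i) = 0 := by
    intro i
    have h1 := X_dvd_iff.1 ((pow_one (X : K⟦X⟧)) ▸ hz 1 i)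
    rwa [map_sub, hI0 1 i, sub_zero] at h1
  have hfix : ∀ i, z i = T z i := by
    intro i
    refine eq_of_forall_X_pow_dvd fun k => ?_
    have h1 := hT _ _ hz0 (hI0 k) k (hz k) i
    rw [← Function.iterate_succ_apply' T] at h1
    have h2 := dvd_sub (hz (k + 1) i) h1
    rw [sub_sub_sub_cancel_right] at h2
    exact (pow_dvd_pow X (by omega)).trans h2
  refine ⟨z, hz0, ?_⟩
  have hd : (fun j => d⁄dX K (z j)) = ((Hf f z)⁻¹).mulVec G := by
    funext j
    rw [hfix j]
    exact derivative_integral _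
  rw [hd, Matrix.mulVec_mulVec, Matrix.mul_nonsing_inv _ (isUnit_det_Hf hf hz0),
    Matrix.one_mulVec]

theorem existsUnique_isSolution {f : Matrix (Fin g) (Fin g) K⟦X⟧} (hf : IsUnit (const f).det)
    (G : Fin g → K⟦X⟧) : ∃! x, IsSolution f G x := by
  obtain ⟨x, hx⟩ := exists_isSolution hf G
  refine ⟨x, hx, fun y hy => funext fun i => eq_of_forall_X_pow_dvd fun k => ?_⟩
  exact (pow_dvd_pow X (by omega)).trans (hy.congr_mod hf hx (n := k) (fun i => by simp) i)

theorem isSolution_solution {f : Matrix (Fin g) (Fin g) K⟦X⟧} (hf : IsUnit (const f).det)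
    (G : Fin g → K⟦X⟧) : IsSolution f G (solution f G) :=
  Classical.epsilon_spec (exists_isSolution hf G)

/-- `X_n(G mod t^n) = X(G) mod t^{n+1}`. -/
theorem solutionMap_mk {f : Matrix (Fin g) (Fin g) K⟦X⟧} (hf : IsUnit (const f).det) (n : ℕ)
    (G : Fin g → K⟦X⟧) (i : Fin g) :
    (solutionMap f n (fun j => Trunc.mk n (G j)) i : Trunc K (n + 1))
      = Trunc.mk (n + 1) (solution f G i) := by
  have h1 := isSolution_solution hf fun i => Quotient.out (Trunc.mk n (G i))
  have h2 := isSolution_solution hf G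
  rw [solutionMap, coe_toF n h1.1, Trunc.mk_eq_mk]
  refine h1.congr_mod hf h2 (fun j => ?_) i
  exact Trunc.mk_eq_mk.1 (Quotient.out_eq' (Trunc.mk n (G j)))

end CharZero

end Algebra

/-! ### The norms and the balls -/

section Norms

variable {K : Type*} [NormedField K] {g n : ℕ}

/-- The Gauss norm on `K_n`: the maximum of the absolute values of the coefficients. -/
def gaussNorm (a : Trunc K n) : ℝ := ⨆ k : Fin n, ‖Trunc.coeff k a‖

/-- The Gauss norm on `F_n`. -/
def normF (x : F K g n) : ℝ := ⨆ i : Fin g, gaussNorm (x i : Trunc K (n + 1))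

/-- The integrated Gauss norm on `E_n`, `‖G‖ = ‖∫ G‖`. -/
def normE (G : E K g n) : ℝ := normF fun i => Trunc.integral (G i)

/-- The closed ball `B_{E_n}(δ)` of center `0`. -/
def ballE (K : Type*) [NormedField K] (g n : ℕ) (δ : ℝ) : Set (E K g n) := {G | normE G ≤ δ}

/-- The closed ball `B_{F_n}(δ)` of center `0`. -/
def ballF (K : Type*) [NormedField K] (g n : ℕ) (δ : ℝ) : Set (F K g n) := {x | normF x ≤ δ}

end Norms

end PadicODE

end

namespace PadicODE

/-! ### Ultrametric estimates for powers and for composition with a primitive -/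

section Estimates

variable {K : Type*} [NormedField K]

/-! The system integrates: with `P(x)_i = ∑ⱼ (∫ f_ij)(x_j)` (`primitiveMap`), the derivative of
`P(x)` is `H_f(x) · x'`, so `x` solves the system exactly when `P(x) = ∫ G` (`isSolution_iff`). As
the norm on `E_n` is that of `∫ G`, the claim becomes: around `x = X(G)`, modulo `t^(n+1)`, `y` has
norm at most `r` if and only if `P(x + y) - P(x)` does.

Write `P(x + y) - P(x) = H_f(0) y + R`. Every monomial of `R` has degree at least 2 in `x, y ∈ t
K⟦t⟧`, so the coefficient of `t^l` in `R` involves only coefficients of index below `l`. If these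
are bounded by `1` for `x` and by `r` for `y`, that coefficient is bounded by `r`: the denominator
`k + 1` introduced by integration is absorbed by the binomial coefficients, up to a factor `1 / |m +
1|` on terms of degree `m + 1` in `y`, and `r^(m+1) / |m + 1| ≤ r` as soon as `r ≤ p^(-1/(p-1))`
(`norm_coeff_subst_integral_sub_le`). Since `H_f(0)` and its inverse are integral, the bound passes
from `y` to `P(x + y) - P(x)`, and back by induction on `l`. The argument thus works up to radius
`p^(-1/(p-1))`. -/

theorem norm_coeff_mul_le [IsUltrametricDist K] {N : ℕ} {a b : K⟦X⟧} {r s : ℝ}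
    (ha : ∀ i < N, ‖coeff i a‖ ≤ r) (hb : ∀ i < N, ‖coeff i b‖ ≤ s) :
    ∀ i < N, ‖coeff i (a * b)‖ ≤ r * s := by
  intro i hi
  have hr : 0 ≤ r := (norm_nonneg _).trans (ha i hi)
  have hs : 0 ≤ s := (norm_nonneg _).trans (hb i hi)
  rw [coeff_mul]
  refine IsUltrametricDist.norm_sum_le_of_forall_le_of_nonneg (mul_nonneg hr hs) fun q hq => ?_
  have hq' := Finset.HasAntidiagonal.mem_antidiagonal.1 hq
  rw [norm_mul]
  exact mul_le_mul (ha _ (by omega)) (hb _ (by omega)) (norm_nonneg _) hr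

theorem norm_coeff_pow_le [IsUltrametricDist K] {N : ℕ} {a : K⟦X⟧} {r : ℝ}
    (ha : ∀ i < N, ‖coeff i a‖ ≤ r) (m : ℕ) : ∀ i < N, ‖coeff i (a ^ m)‖ ≤ r ^ m := by
  induction m with
  | zero =>
    intro i _
    rw [pow_zero, pow_zero, coeff_one]
    split_ifs <;> simp
  | succ m ih =>
    rw [pow_succ, pow_succ]
    exact norm_coeff_mul_le ih ha

/-- A monomial of degree at least `2` in `x, y ∈ t K⟦t⟧`: its coefficient of `t^l` only involves
the coefficients of `x` and `y` of lower order. -/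
theorem norm_coeff_pow_mul_pow_le [IsUltrametricDist K] {l a m : ℕ} (hm : 2 ≤ m + a) {x y : K⟦X⟧}
    {r : ℝ} (hr : 0 ≤ r) (hx0 : constantCoeff x = 0) (hy0 : constantCoeff y = 0)
    (hx : ∀ i < l, ‖coeff i x‖ ≤ 1) (hy : ∀ i < l, ‖coeff i y‖ ≤ r) :
    ‖coeff l (y ^ m * x ^ a)‖ ≤ r ^ m := by
  obtain ⟨u, rfl⟩ := X_dvd_iff.2 hx0
  obtain ⟨z, rfl⟩ := X_dvd_iff.2 hy0
  have hu : ∀ i < l - 1, ‖coeff i u‖ ≤ 1 := fun i hi => by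
    simpa [coeff_succ_X_mul] using hx (i + 1) (by omega)
  have hz : ∀ i < l - 1, ‖coeff i z‖ ≤ r := fun i hi => by
    simpa [coeff_succ_X_mul] using hy (i + 1) (by omega)
  -- With `t^(m+a)` factored out, only the coefficient of index `l - (m + a) ≤ l - 2` of `z^m u^a`
  -- matters, within the range where `u` and `z` are controlled.
  have e : (X * z) ^ m * (X * u) ^ a = X ^ (m + a) * (z ^ m * u ^ a) := by ring
  rw [e, coeff_X_pow_mul']
  split_ifs with h
  · have := norm_coeff_mul_le (norm_coeff_pow_le hz m) (norm_coeff_pow_le hu a) (l - (m + a))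
      (by omega)
    simpa using this
  · simpa using pow_nonneg hr m

theorem norm_natCast_eq (p : ℕ) [Fact p.Prime] [NormedAlgebra ℚ_[p] K] {m : ℕ} (hm : m ≠ 0) :
    ‖(m : K)‖ = ((p : ℝ) ^ padicValNat p m)⁻¹ := by
  have h1 : (m : K) = algebraMap ℚ_[p] K (m : ℚ_[p]) := (map_natCast _ m).symm
  have hm' : (m : ℚ_[p]) ≠ 0 := by exact_mod_cast hm
  rw [h1, norm_algebraMap', Padic.norm_eq_zpow_neg_valuation hm', Padic.valuation_natCast,
    zpow_neg, zpow_natCast]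

/-- Below the radius of convergence of the exponential, `r^m / |m| ≤ r`. -/
theorem pow_succ_le_mul_norm (p : ℕ) [hp : Fact p.Prime] [NormedAlgebra ℚ_[p] K] {r : ℝ}
    (hr : 0 ≤ r) (hr' : r ≤ (p : ℝ) ^ (-1 / ((p : ℝ) - 1))) (m : ℕ) :
    r ^ (m + 1) ≤ r * ‖((m + 1 : ℕ) : K)‖ := by
  have hp1 : (1 : ℝ) < p := by exact_mod_cast hp.out.one_lt
  have hp0 : (0 : ℝ) < p - 1 := by linarith
  rw [norm_natCast_eq p m.succ_ne_zero, pow_succ']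
  refine mul_le_mul_of_nonneg_left ?_ hr
  set v := padicValNat p (m + 1) with hv
  have h1 : (p : ℝ) ^ v ≤ m + 1 := by
    exact_mod_cast Nat.le_of_dvd m.succ_pos pow_padicValNat_dvd
  -- Bernoulli's inequality: together with `p^v ≤ m + 1` it gives `v ≤ m / (p - 1)`, the source of
  -- the exponent `-1/(p-1)`.
  have h2 : 1 + (v : ℝ) * (p - 1) ≤ (p : ℝ) ^ v := by
    have := one_add_mul_le_pow (a := (p : ℝ) - 1) (by linarith) v
    simpa using this
  have h3 : (v : ℝ) ≤ m / (p - 1) := by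
    rw [le_div_iff₀ hp0]; linarith
  calc r ^ m ≤ ((p : ℝ) ^ (-1 / ((p : ℝ) - 1))) ^ m := pow_le_pow_left₀ hr hr' m
    _ = (p : ℝ) ^ (-(m / ((p : ℝ) - 1))) := by
        rw [← Real.rpow_mul_natCast (by linarith)]
        congr 1
        ring
    _ ≤ (p : ℝ) ^ (-(v : ℝ)) := Real.rpow_le_rpow_of_exponent_le hp1.le (by linarith)
    _ = ((p : ℝ) ^ v)⁻¹ := by rw [Real.rpow_neg (by linarith), Real.rpow_natCast]

/-- The identity `(m + 1) * choose (k + 1) (m + 1) = (k + 1) * choose k m` extracts the factor `|k +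
1|`, which later cancels the denominator of the primitive; the remaining `1 / |m + 1|` is paid for
by `r^(m+1) ≤ r |m + 1|`. The condition `1 ≤ k` excludes the linear term, which would involve `coeff
l y` itself. -/
theorem norm_coeff_add_pow_sub_pow_le (p : ℕ) [Fact p.Prime] [NormedAlgebra ℚ_[p] K] {r : ℝ}
    (hr : 0 ≤ r) (hr' : r ≤ (p : ℝ) ^ (-1 / ((p : ℝ) - 1))) {x y : K⟦X⟧} {l k : ℕ} (hk : 1 ≤ k)
    (hx0 : constantCoeff x = 0) (hy0 : constantCoeff y = 0)
    (hx : ∀ i < l, ‖coeff i x‖ ≤ 1) (hy : ∀ i < l, ‖coeff i y‖ ≤ r) :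
    ‖coeff l ((y + x) ^ (k + 1) - x ^ (k + 1))‖ ≤ ‖((k + 1 : ℕ) : K)‖ * r := by
  have : IsUltrametricDist K := IsUltrametricDist.of_normedAlgebra ℚ_[p]
  rw [add_pow, Finset.sum_range_succ']
  simp only [pow_zero, one_mul, tsub_zero, Nat.choose_zero_right, Nat.cast_one, mul_one,
    add_sub_cancel_right, map_sum]
  refine IsUltrametricDist.norm_sum_le_of_forall_le_of_nonneg
    (mul_nonneg (norm_nonneg _) hr) fun m hm => ?_
  have hm' := Finset.mem_range.1 hm
  have h1 := norm_coeff_pow_mul_pow_le (m := m + 1) (a := k + 1 - (m + 1)) (by omega) hr hx0 hy0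
    hx hy
  have h2 : ‖(((k + 1).choose (m + 1) : ℕ) : K)‖ * ‖((m + 1 : ℕ) : K)‖ ≤ ‖((k + 1 : ℕ) : K)‖ := by
    rw [← norm_mul, ← Nat.cast_mul, ← Nat.add_one_mul_choose_eq, Nat.cast_mul, norm_mul]
    exact mul_le_of_le_one_right (norm_nonneg _) (IsUltrametricDist.norm_natCast_le_one K _)
  rw [← map_natCast (C (R := K)), mul_comm _ (C _), coeff_C_mul, norm_mul]
  calc _ ≤ ‖(((k + 1).choose (m + 1) : ℕ) : K)‖ * (r * ‖((m + 1 : ℕ) : K)‖) :=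
        mul_le_mul_of_nonneg_left (h1.trans (pow_succ_le_mul_norm p hr hr' m)) (norm_nonneg _)
    _ = ‖(((k + 1).choose (m + 1) : ℕ) : K)‖ * ‖((m + 1 : ℕ) : K)‖ * r := by ring
    _ ≤ _ := mul_le_mul_of_nonneg_right h2 hr

theorem coeff_subst_eq_sum (φ : K⟦X⟧) {w : K⟦X⟧} (hw : constantCoeff w = 0) {l N : ℕ}
    (hN : l < N) : coeff l (φ.subst w) = ∑ d ∈ Finset.range N, coeff d φ * coeff l (w ^ d) := by
  rw [coeff_subst' (HasSubst.of_constantCoeff_zero' hw)]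
  refine finsum_eq_sum_of_support_subset _ fun d hd => ?_
  simp only [Finset.coe_range, Set.mem_Iio]
  by_contra h
  refine hd ?_
  have := X_pow_dvd_iff.1 (pow_dvd_pow_of_dvd (X_dvd_iff.2 hw) d) l (by omega)
  simp [this]

/-- The primitive of a power series with integral coefficients is, up to an error of size `r`,
linear around integral points on balls of radius `r`. -/
theorem norm_coeff_subst_integral_sub_le (p : ℕ) [Fact p.Prime] [NormedAlgebra ℚ_[p] K] {r : ℝ}
    (hr : 0 ≤ r) (hr' : r ≤ (p : ℝ) ^ (-1 / ((p : ℝ) - 1))) {φ x y : K⟦X⟧} {l : ℕ}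
    (hφ : ∀ k, ‖coeff k φ‖ ≤ 1) (hx0 : constantCoeff x = 0) (hy0 : constantCoeff y = 0)
    (hx : ∀ i < l, ‖coeff i x‖ ≤ 1) (hy : ∀ i < l, ‖coeff i y‖ ≤ r) :
    ‖coeff l ((integral φ).subst (y + x) - (integral φ).subst x)
      - constantCoeff φ * coeff l y‖ ≤ r := by
  have : IsUltrametricDist K := IsUltrametricDist.of_normedAlgebra ℚ_[p]
  have : CharZero K := charZero_of_injective_algebraMap (algebraMap ℚ_[p] K).injective
  -- Cutting at `l + 2` rather than `l + 1` leaves degrees 0 and 1 to split off even when `l = 0`.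
  rw [map_sub, coeff_subst_eq_sum _ (by simp [hx0, hy0]) (show l < l + 2 by omega),
    coeff_subst_eq_sum _ hx0 (show l < l + 2 by omega), ← Finset.sum_sub_distrib,
    Finset.sum_range_succ', Finset.sum_range_succ']
  -- Degree 0 contributes nothing, and degree 1 cancels the subtracted linear term exactly.
  have e : ∀ s : K, s + (coeff (0 + 1) (integral φ) * coeff l ((y + x) ^ (0 + 1)) -
        coeff (0 + 1) (integral φ) * coeff l (x ^ (0 + 1))) +
      (coeff 0 (integral φ) * coeff l ((y + x) ^ 0) - coeff 0 (integral φ) * coeff l (x ^ 0))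
      - constantCoeff φ * coeff l y = s := by
    intro s
    rw [coeff_succ_integral]
    simp [mul_add]
  rw [e]
  refine IsUltrametricDist.norm_sum_le_of_forall_le_of_nonneg hr fun k _ => ?_
  have h1 := norm_coeff_add_pow_sub_pow_le p hr hr' (k := k + 1) (by omega) hx0 hy0 hx hy
  rw [← mul_sub, ← map_sub, norm_mul, coeff_succ_integral, norm_div, div_mul_eq_mul_div]
  have h0 : ((k + 1 + 1 : ℕ) : K) ≠ 0 := Nat.cast_ne_zero.2 (Nat.succ_ne_zero _)
  have hc : ((k + 1 : ℕ) : K) + 1 = ((k + 1 + 1 : ℕ) : K) := by push_cast; ring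
  rw [hc, div_le_iff₀ (norm_pos_iff.2 h0)]
  calc ‖coeff (k + 1) φ‖ * ‖coeff l ((y + x) ^ (k + 1 + 1) - x ^ (k + 1 + 1))‖
      ≤ 1 * (‖((k + 1 + 1 : ℕ) : K)‖ * r) :=
        mul_le_mul (hφ _) h1 (norm_nonneg _) zero_le_one
    _ = r * ‖((k + 1 + 1 : ℕ) : K)‖ := by ring

end Estimates

/-! ### The integrated system and its variation on balls -/

section Primitive

variable {K : Type*} [NormedField K] {g : ℕ}

/-- The vector `(∑ⱼ (∫ f_{ij})(x_j))_i`, whose derivative is `H_f(x) · x'`. -/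
noncomputable def primitiveMap (f : Matrix (Fin g) (Fin g) K⟦X⟧) (x : Fin g → K⟦X⟧) (i : Fin g) :
    K⟦X⟧ := ∑ j, (integral (f i j)).subst (x j)

theorem constantCoeff_primitiveMap (f : Matrix (Fin g) (Fin g) K⟦X⟧) {x : Fin g → K⟦X⟧}
    (hx : ∀ i, constantCoeff (x i) = 0) (i : Fin g) : constantCoeff (primitiveMap f x i) = 0 := by
  rw [primitiveMap, map_sum]
  refine Finset.sum_eq_zero fun j _ => ?_
  rw [← coeff_zero_eq_constantCoeff_apply, coeff_subst_eq_sum _ (hx j) zero_lt_one]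
  simp [constantCoeff_integral]

theorem derivative_primitiveMap [CharZero K] (f : Matrix (Fin g) (Fin g) K⟦X⟧)
    {x : Fin g → K⟦X⟧} (hx : ∀ i, constantCoeff (x i) = 0) (i : Fin g) :
    d⁄dX K (primitiveMap f x i) = (Hf f x).mulVec (fun j => d⁄dX K (x j)) i := by
  rw [primitiveMap, map_sum, Matrix.mulVec, dotProduct]
  refine Finset.sum_congr rfl fun j _ => ?_
  rw [derivative_subst (HasSubst.of_constantCoeff_zero' (hx j)), derivative_integral]
  rfl

/-- The matrix with coefficients in `K` of the constant term bounds the variation of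
`primitiveMap`, up to an error of size `r`. -/
theorem norm_coeff_primitiveMap_sub_le (p : ℕ) [Fact p.Prime] [NormedAlgebra ℚ_[p] K] {r : ℝ}
    (hr : 0 ≤ r) (hr' : r ≤ (p : ℝ) ^ (-1 / ((p : ℝ) - 1)))
    {f : Matrix (Fin g) (Fin g) K⟦X⟧} {x y : Fin g → K⟦X⟧} {l : ℕ}
    (hf : ∀ i j k, ‖coeff k (f i j)‖ ≤ 1) (hx0 : ∀ i, constantCoeff (x i) = 0)
    (hy0 : ∀ i, constantCoeff (y i) = 0) (hx : ∀ j, ∀ i < l, ‖coeff i (x j)‖ ≤ 1)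
    (hy : ∀ j, ∀ i < l, ‖coeff i (y j)‖ ≤ r) (i : Fin g) :
    ‖coeff l (primitiveMap f (y + x) i - primitiveMap f x i)
      - (const f).mulVec (fun j => coeff l (y j)) i‖ ≤ r := by
  have : IsUltrametricDist K := IsUltrametricDist.of_normedAlgebra ℚ_[p]
  rw [primitiveMap, primitiveMap, ← Finset.sum_sub_distrib, map_sum, Matrix.mulVec, dotProduct,
    ← Finset.sum_sub_distrib]
  exact IsUltrametricDist.norm_sum_le_of_forall_le_of_nonneg hr fun j _ =>
    norm_coeff_subst_integral_sub_le p hr hr' (hf i j) (hx0 j) (hy0 j) (hx j) (hy j)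

theorem norm_mulVec_le [IsUltrametricDist K] {M : Matrix (Fin g) (Fin g) K}
    (hM : ∀ i j, ‖M i j‖ ≤ 1) {v : Fin g → K} {r : ℝ} (hr : 0 ≤ r) (hv : ∀ j, ‖v j‖ ≤ r)
    (i : Fin g) : ‖M.mulVec v i‖ ≤ r := by
  rw [Matrix.mulVec, dotProduct]
  refine IsUltrametricDist.norm_sum_le_of_forall_le_of_nonneg hr fun j _ => ?_
  rw [norm_mul]
  calc _ ≤ 1 * r := mul_le_mul (hM i j) (hv j) (norm_nonneg _) zero_le_one
    _ = r := one_mul r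

theorem norm_coeff_primitiveMap_sub_le_of_norm_coeff_le (p : ℕ) [Fact p.Prime]
    [NormedAlgebra ℚ_[p] K] {r : ℝ}
    (hr : 0 ≤ r) (hr' : r ≤ (p : ℝ) ^ (-1 / ((p : ℝ) - 1)))
    {f : Matrix (Fin g) (Fin g) K⟦X⟧} {x y : Fin g → K⟦X⟧} {n : ℕ}
    (hf : ∀ i j k, ‖coeff k (f i j)‖ ≤ 1) (hx0 : ∀ i, constantCoeff (x i) = 0)
    (hy0 : ∀ i, constantCoeff (y i) = 0) (hx : ∀ j, ∀ i < n, ‖coeff i (x j)‖ ≤ 1)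
    (hy : ∀ j, ∀ i ≤ n, ‖coeff i (y j)‖ ≤ r) (i : Fin g) {l : ℕ} (hl : l ≤ n) :
    ‖coeff l (primitiveMap f (y + x) i - primitiveMap f x i)‖ ≤ r := by
  have : IsUltrametricDist K := IsUltrametricDist.of_normedAlgebra ℚ_[p]
  have h1 := norm_coeff_primitiveMap_sub_le p hr hr' hf hx0 hy0 (l := l)
    (fun j i hi => hx j i (by omega)) (fun j i hi => hy j i (by omega)) i
  have h2 := norm_mulVec_le (M := const f)
    (fun i j => by simpa [const] using hf i j 0) hr (fun j => hy j l hl) i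
  have h3 := (IsUltrametricDist.norm_add_le_max _ _).trans (max_le h1 h2)
  rwa [sub_add_cancel] at h3

/-- Strong induction on `l`: the bounds on lower coefficients of `y` control the error term, so
`H_f(0)` applied to the `l`-th coefficient vector is bounded by `r`, and the integral inverse `N`
transfers this to the vector itself. Only indices below `n` of `x` enter, which is why integrality
modulo `t^n` suffices. -/
theorem norm_coeff_le_of_norm_coeff_primitiveMap_sub_le (p : ℕ) [Fact p.Prime]
    [NormedAlgebra ℚ_[p] K] {r : ℝ}
    (hr : 0 ≤ r) (hr' : r ≤ (p : ℝ) ^ (-1 / ((p : ℝ) - 1)))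
    {f : Matrix (Fin g) (Fin g) K⟦X⟧} {x y : Fin g → K⟦X⟧} {n : ℕ}
    (hf : ∀ i j k, ‖coeff k (f i j)‖ ≤ 1) {N : Matrix (Fin g) (Fin g) K}
    (hN : ∀ i j, ‖N i j‖ ≤ 1) (hNf : N * const f = 1) (hx0 : ∀ i, constantCoeff (x i) = 0)
    (hy0 : ∀ i, constantCoeff (y i) = 0) (hx : ∀ j, ∀ i < n, ‖coeff i (x j)‖ ≤ 1)
    (h : ∀ i, ∀ l ≤ n, ‖coeff l (primitiveMap f (y + x) i - primitiveMap f x i)‖ ≤ r) :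
    ∀ l ≤ n, ∀ i, ‖coeff l (y i)‖ ≤ r := by
  have : IsUltrametricDist K := IsUltrametricDist.of_normedAlgebra ℚ_[p]
  intro l
  induction l using Nat.strong_induction_on with
  | _ l ih =>
    intro hl i
    have h1 : ∀ i, ‖(const f).mulVec (fun j => coeff l (y j)) i‖ ≤ r := by
      intro i
      have h2 := norm_coeff_primitiveMap_sub_le p hr hr' hf hx0 hy0 (l := l)
        (fun j i hi => hx j i (by omega)) (fun j i hi => ih i hi (by omega) j) i
      rw [norm_sub_rev] at h2
      have h3 := (IsUltrametricDist.norm_add_le_max _ _).trans (max_le h2 (h i l hl))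
      rwa [sub_add_cancel] at h3
    have h2 := norm_mulVec_le hN hr h1 i
    rwa [Matrix.mulVec_mulVec, hNf, Matrix.one_mulVec] at h2

end Primitive

/-! ### Gauss norms computed on representatives -/

section Balls

variable {K : Type*} [NormedField K] {g n : ℕ}

theorem normF_nonneg (x : F K g n) : 0 ≤ normF x :=
  Real.iSup_nonneg fun _ => Real.iSup_nonneg fun _ => norm_nonneg _

/-- For `g = 0` the supremum is `0` while the right-hand side is vacuous, so the equivalence would
fail for negative `r`. -/
theorem normF_le_iff (hg : 0 < g) (x : F K g n) {r : ℝ} :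
    normF x ≤ r ↔ ∀ i, ∀ k : Fin (n + 1), ‖Trunc.coeff k (x i : Trunc K (n + 1))‖ ≤ r := by
  have : Nonempty (Fin g) := ⟨⟨0, hg⟩⟩
  rw [normF, ciSup_le_iff (Set.finite_range _).bddAbove]
  refine forall_congr' fun i => ?_
  rw [gaussNorm, ciSup_le_iff (Set.finite_range _).bddAbove]

theorem normF_le_iff_of_mk (hg : 0 < g) {x : F K g n} {a : Fin g → K⟦X⟧}
    (hx : ∀ i, (x i : Trunc K (n + 1)) = Trunc.mk (n + 1) (a i)) {r : ℝ} :
    normF x ≤ r ↔ ∀ i, ∀ k ≤ n, ‖coeff k (a i)‖ ≤ r := by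
  rw [normF_le_iff hg]
  refine forall_congr' fun i => ?_
  rw [hx]
  exact ⟨fun h k hk => h ⟨k, by omega⟩, fun h k => h k (by omega)⟩

theorem exists_mk_eq (x : F K g n) : ∃ a : Fin g → K⟦X⟧, (∀ i, constantCoeff (a i) = 0) ∧
    ∀ i, (x i : Trunc K (n + 1)) = Trunc.mk (n + 1) (a i) := by
  have h : ∀ i, ∃ a : K⟦X⟧, constantCoeff a = 0 ∧
      (x i : Trunc K (n + 1)) = Trunc.mk (n + 1) a := by
    intro i
    obtain ⟨b, hb⟩ := Ideal.mem_span_singleton.1 (x i).2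
    obtain ⟨c, rfl⟩ := Ideal.Quotient.mk_surjective b
    exact ⟨X * c, by simp, by rw [hb]; exact (map_mul _ _ _).symm⟩
  choose a ha using h
  exact ⟨a, fun i => (ha i).1, fun i => (ha i).2⟩

theorem mem_ballE_iff_of_mk (hg : 0 < g) {D : Fin g → K⟦X⟧} {r : ℝ} :
    (fun i => Trunc.mk n (D i)) ∈ ballE K g n r ↔
      ∀ i, ∀ k ≤ n, ‖coeff k (integral (D i))‖ ≤ r :=
  normF_le_iff_of_mk hg fun i => Trunc.integral_mk (D i)

end Balls

/-! ### Integration of the system and images of balls -/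

section Main

variable {K : Type*} [NormedField K] [CharZero K] {g n : ℕ}

/-- The differential system is equivalent to the algebraic system `primitiveMap f x = ∫ G`. -/
theorem isSolution_iff {f : Matrix (Fin g) (Fin g) K⟦X⟧} {G x : Fin g → K⟦X⟧}
    (hx : ∀ i, constantCoeff (x i) = 0) :
    IsSolution f G x ↔ ∀ i, primitiveMap f x i = integral (G i) := by
  constructor
  · intro h i
    refine derivative.ext ?_ ?_
    · rw [derivative_primitiveMap f hx, h.2, derivative_integral]
    · rw [constantCoeff_primitiveMap f hx, constantCoeff_integral]
  · intro h
    refine ⟨hx, funext fun i => ?_⟩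
    rw [← derivative_primitiveMap f hx, h, derivative_integral]

theorem integral_add (a b : K⟦X⟧) : integral (a + b) = integral a + integral b := by
  refine derivative.ext ?_ ?_
  · rw [map_add, derivative_integral, derivative_integral, derivative_integral]
  · rw [map_add, constantCoeff_integral, constantCoeff_integral, constantCoeff_integral, add_zero]

theorem integral_derivative {a : K⟦X⟧} (ha : constantCoeff a = 0) : integral (d⁄dX K a) = a := by
  refine derivative.ext ?_ ?_
  · rw [derivative_integral]
  · rw [constantCoeff_integral, ha]

/-- The image of a ball by the solution map, for any radius at most `p^{-1/(p-1)}`. -/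
theorem solutionMap_image_ballE (p : ℕ) [Fact p.Prime] [NormedAlgebra ℚ_[p] K] (hg : 0 < g)
    {f : Matrix (Fin g) (Fin g) K⟦X⟧} (hf : ∀ i j k, ‖coeff k (f i j)‖ ≤ 1)
    {N : Matrix (Fin g) (Fin g) K} (hN : ∀ i j, ‖N i j‖ ≤ 1) (hNf : N * const f = 1)
    (G : E K g n)
    (hX : ∀ (i : Fin g) (k : Fin (n + 1)), (k : ℕ) < n →
      ‖Trunc.coeff k (solutionMap f n G i : Trunc K (n + 1))‖ ≤ 1)
    {δ : ℝ} (hδ : δ ≤ (p : ℝ) ^ (-1 / ((p : ℝ) - 1))) :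
    solutionMap f n '' ((fun D => G + D) '' ballE K g n δ) =
      (fun D => solutionMap f n G + D) '' ballF K g n δ := by
  have hu : IsUnit (const f).det := Matrix.isUnit_det_of_left_inverse hNf
  obtain ⟨G, rfl⟩ : ∃ a : Fin g → K⟦X⟧, G = fun i => Trunc.mk n (a i) :=
    ⟨fun i => Quotient.out (G i), funext fun i => (Quotient.out_eq' (G i)).symm⟩
  set x := solution f G with hxdef
  have hx : IsSolution f G x := isSolution_solution hu G
  have hmk := solutionMap_mk hu n G
  have hx1 : ∀ j, ∀ i < n, ‖coeff i (x j)‖ ≤ 1 := by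
    intro j i hi
    have := hX j ⟨i, by omega⟩ hi
    rwa [hmk] at this
  have hxP := (isSolution_iff hx.1).1 hx
  ext w
  constructor
  · rintro ⟨_, ⟨D, hD, rfl⟩, rfl⟩
    obtain ⟨D, rfl⟩ : ∃ a : Fin g → K⟦X⟧, D = fun i => Trunc.mk n (a i) :=
      ⟨fun i => Quotient.out (D i), funext fun i => (Quotient.out_eq' (D i)).symm⟩
    -- For negative `δ` both balls are empty; a point of the ball forces `0 ≤ δ`.
    have hδ0 : 0 ≤ δ := (normF_nonneg _).trans hD
    have hmk' := solutionMap_mk hu n (G + D)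
    have hx' := isSolution_solution hu (G + D)
    set x' := solution f (G + D) with hxdef'
    have hxP' := (isSolution_iff hx'.1).1 hx'
    rw [mem_ballE_iff_of_mk hg] at hD
    -- With `y = x' - x`, the variation of `primitiveMap` is `∫ (G + D) - ∫ G = ∫ D`.
    have key := norm_coeff_le_of_norm_coeff_primitiveMap_sub_le p hδ0 hδ (n := n) (y := x' - x)
      hf hN hNf hx.1 (fun i => by simp [hx.1, hx'.1]) hx1 (fun i l hl => by
        rw [sub_add_cancel, hxP, hxP', Pi.add_apply, integral_add, add_sub_cancel_left]
        exact hD i l hl)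
    refine ⟨solutionMap f n (fun i => Trunc.mk n ((G + D) i)) -
      solutionMap f n (fun i => Trunc.mk n (G i)), ?_, add_sub_cancel _ _⟩
    refine (normF_le_iff_of_mk hg (a := x' - x) fun i => ?_).2 fun i k hk => key k hk i
    rw [Pi.sub_apply, AddSubgroupClass.coe_sub, hmk, hmk']
    exact (map_sub _ _ _).symm
  · rintro ⟨Y, hY, rfl⟩
    have hδ0 : 0 ≤ δ := (normF_nonneg _).trans hY
    obtain ⟨y, hy0, hy⟩ := exists_mk_eq Y
    have hY' := (normF_le_iff_of_mk hg hy).1 hY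
    have hyx : ∀ i, constantCoeff ((y + x) i) = 0 := fun i => by simp [hy0, hx.1]
    have key := fun i l (hl : l ≤ n) => norm_coeff_primitiveMap_sub_le_of_norm_coeff_le p hδ0 hδ
      hf hx.1 hy0 hx1 hY' i hl
    -- The perturbation is chosen so that `∫ D` is the variation of `primitiveMap`; then `y + x`
    -- solves the system for `G + D`, and uniqueness identifies it with `solution f (G + D)`.
    let D : Fin g → K⟦X⟧ := fun i => d⁄dX K (primitiveMap f (y + x) i - primitiveMap f x i)
    have hD : ∀ i, integral (D i) = primitiveMap f (y + x) i - primitiveMap f x i := fun i =>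
      integral_derivative (by
        rw [map_sub, constantCoeff_primitiveMap f hyx, constantCoeff_primitiveMap f hx.1, sub_zero])
    have hsol : IsSolution f (G + D) (y + x) := by
      rw [isSolution_iff hyx]
      intro i
      rw [Pi.add_apply, integral_add, hD, ← hxP, add_sub_cancel]
    refine ⟨fun i => Trunc.mk n ((G + D) i), ⟨fun i => Trunc.mk n (D i), ?_, ?_⟩, ?_⟩
    · rw [mem_ballE_iff_of_mk hg]
      intro i k hk
      rw [hD]
      exact key i k hk
    · funext i
      exact (map_add (Ideal.Quotient.mk _) (G i) (D i)).symm
    · funext i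
      refine Subtype.ext ?_
      have : solution f (G + D) = y + x :=
        (existsUnique_isSolution hu (G + D)).unique (isSolution_solution hu _) hsol
      rw [solutionMap_mk hu, this]
      simp only [Pi.add_apply]
      rw [AddMemClass.coe_add, hmk, hy, add_comm (Trunc.mk (n + 1) _)]
      exact map_add (Ideal.Quotient.mk _) (y i) (x i)

end Main

end PadicODE

theorem mainTheorem2 (p : ℕ) [Fact p.Prime] (K : Type*) [NormedField K] [NormedAlgebra ℚ_[p] K]
    [FiniteDimensional ℚ_[p] K] (g n : ℕ) (hg : 0 < g) (hn : 0 < n)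
    (f : Matrix (Fin g) (Fin g) K⟦X⟧)
    (hf : ∀ i j k, PowerSeries.coeff k (f i j) ∈ PadicODE.integerRing p K)
    (hf0 : ∃ U : Matrix.GeneralLinearGroup (Fin g) (PadicODE.integerRing p K),
      ∀ i j, PadicODE.Hf f 0 i j = PowerSeries.C ((U i j : PadicODE.integerRing p K) : K))
    (G : PadicODE.E K g n)
    (hG : ∀ (i : Fin g) (k : Fin n), PadicODE.Trunc.coeff k (G i) ∈ PadicODE.integerRing p K)
    (hX : ∀ (i : Fin g) (k : Fin (n + 1)), (k : ℕ) < n →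
      PadicODE.Trunc.coeff k (PadicODE.solutionMap f n G i : PadicODE.Trunc K (n + 1)) ∈
        PadicODE.integerRing p K)
    (δ : ℝ) (hδ : δ < (p : ℝ) ^ (-2 / ((p : ℝ) - 1))) :
    PadicODE.solutionMap f n '' ((fun D => G + D) '' PadicODE.ballE K g n δ) =
      (fun D => PadicODE.solutionMap f n G + D) '' PadicODE.ballF K g n δ := by
  have : CharZero K := charZero_of_injective_algebraMap (algebraMap ℚ_[p] K).injective
  obtain ⟨U, hU⟩ := hf0
  -- The constant term of `H_f` is the image of `U`, so the image of `U⁻¹` is the integral left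
  -- inverse `N`.
  have hUf : PadicODE.const f =
      (PadicODE.integerRing p K).subtype.mapMatrix (U : Matrix (Fin g) (Fin g) _) := by
    ext i j
    have h := hU i j
    rw [PadicODE.Hf_zero] at h
    exact PowerSeries.C_injective h
  have hp1 : (1 : ℝ) < p := by exact_mod_cast (Fact.out : p.Prime).one_lt
  refine PadicODE.solutionMap_image_ballE p hg hf
    (N := (PadicODE.integerRing p K).subtype.mapMatrix
      ((U⁻¹ : Matrix.GeneralLinearGroup (Fin g) _) : Matrix (Fin g) (Fin g) _))
    (fun i j => Subtype.property (((U⁻¹ : Matrix.GeneralLinearGroup (Fin g) _) :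
      Matrix (Fin g) (Fin g) (PadicODE.integerRing p K)) i j)) ?_ G hX (hδ.le.trans ?_)
  · rw [hUf, ← map_mul, ← Units.val_mul, inv_mul_cancel, Units.val_one, map_one]
  -- The radius `p^(-2/(p-1))` lies below the threshold `p^(-1/(p-1))`.
  · refine Real.rpow_le_rpow_of_exponent_le hp1.le ?_
    exact div_le_div_of_nonneg_right (by norm_num) (by linarith)
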